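/- Let $\mathcal H$ be a complex separable Hilbert space (possibly finite-dimensional). Call a bounded operator $A$ on $\mathcal H$ a partial isometry if $A^*A$ and $AA^*$ are both self-adjoint projections. Let $\mathcal S$ be a set of partial isometries on $\mathcal H$ that is closed under multiplication, is irreducible (the only closed subspaces of $\mathcal H$ invariant under every operator in $\mathcal S$ are $\{0\}$ and $\mathcal H$), and contains a non-zero compact operator; $\mathcal S$ is not assumed to be closed under adjoints or norm-closed. Then the self-adjoint semigroup generated by $\mathcal S$, that is, the set of all finite products $A_1A_2\cdots A_k$ with $k\ge 1$ and, for each $i$, $A_i\in\mathcal S$ or $A_i^*\in\mathcal S$, consists of partial isometries. -/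

import Mathlib

open scoped Pointwise

/-- A bounded operator `A` on a Hilbert space is a partial isometry if both `A* A` and `A A*` are
self-adjoint projections. -/
def IsPartialIsometry {H : Type*} [NormedAddCommGroup H] [InnerProductSpace ℂ H] [CompleteSpace H]
    (A : H →L[ℂ] H) : Prop :=
  IsStarProjection (star A * A) ∧ IsStarProjection (A * star A)

/-- A semigroup of bounded operators is irreducible if the only closed subspaces invariant under
all its members are `{0}` and the whole space. -/
def IsIrreducibleSemigroup {H : Type*} [NormedAddCommGroup H] [InnerProductSpace ℂ H]
    (S : Subsemigroup (H →L[ℂ] H)) : Prop :=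
  ∀ M : Submodule ℂ H, IsClosed (M : Set H) →
    (∀ A ∈ S, ∀ x ∈ M, A x ∈ M) → M = ⊥ ∨ M = ⊤

/-- The self-adjoint semigroup generated by `S`: the multiplicative semigroup generated by the
members of `S` and their adjoints (`star` is the Hilbert space adjoint, applied elementwise). -/
noncomputable def selfAdjointSemigroupGenerated {H : Type*} [NormedAddCommGroup H]
    [InnerProductSpace ℂ H] [CompleteSpace H] (S : Subsemigroup (H →L[ℂ] H)) :
    Subsemigroup (H →L[ℂ] H) :=
  Subsemigroup.closure ((S : Set (H →L[ℂ] H)) ∪ star (S : Set (H →L[ℂ] H)))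

/-! ### Identities for partial isometries in a C*-ring. -/

section CStarRing

variable {R : Type*} [NormedRing R] [StarRing R] [CStarRing R] {A B : R}

/-! A compact partial isometry has finite rank, so `S` has non-zero members of least finite rank;
let F be the family of their ranges. If `A ∈ S` does not kill a block M in F, minimality prevents it
from losing rank there, and since the product is a partial isometry, `A` is isometric on M and
carries it onto another block. Irreducibility makes F also the family of initial spaces of
minimal-rank members, so adjoints permute blocks in the same way. Unlike being a partial isometry,
this block property passes to products. It gives `W * star W * W = W` on every block, and the blocks
span a dense subspace. -/

theorem mul_star_mul_self_of_isStarProjection (h : IsStarProjection (star A * A)) :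
    A * star A * A = A := by
  have e : star A * A * (star A * A) = star A * A := h.isIdempotentElem
  -- By the C*-identity, an element `X` vanishes once `star X * X` does.
  rw [← sub_eq_zero, ← CStarRing.star_mul_self_eq_zero_iff]
  calc star (A * star A * A - A) * (A * star A * A - A)
      = star A * A * (star A * A) * (star A * A) - star A * A * (star A * A)
        - (star A * A * (star A * A) - star A * A) := by
        simp only [star_sub, star_mul, star_star]; noncomm_ring
    _ = 0 := by simp [e]

/-- If `A`, `B` and `A * B` are partial isometries, then the initial projection of `A` fixes
`B * star (A * B)`. -/
theorem star_mul_self_mul_mul_star_mul (hA : A * star A * A = A) (hB : B * star B * B = B)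
    (hAB : A * B * star (A * B) * (A * B) = A * B) :
    star A * A * (B * star (A * B)) = B * star (A * B) := by
  rw [eq_comm, ← sub_eq_zero, ← CStarRing.star_mul_self_eq_zero_iff]
  set C := A * B with hC
  have hCB : C * star B * B = C := by rw [hC, mul_assoc, mul_assoc, ← mul_assoc B, hB]
  have hsC : star C = star B * star A := by rw [hC, star_mul]
  calc star (B * star C - star A * A * (B * star C)) * (B * star C - star A * A * (B * star C))
      = C * star B * B * star C - C * (star B * star A) * (A * B) * star C
        - C * star B * star A * A * B * star C
        + C * star B * star A * (A * star A * A) * B * star C := by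
        simp only [star_sub, star_mul, star_star]; noncomm_ring
    _ = C * star B * B * star C - C * (star B * star A) * (A * B) * star C := by
        rw [hA]; noncomm_ring
    _ = 0 := by rw [hCB, ← hsC, ← hC, hAB, sub_self]

end CStarRing

/-! ### Ranks of products and adjoints. -/

section Range

variable {H : Type*} [NormedAddCommGroup H] [InnerProductSpace ℂ H]

theorem range_mul (A B : H →L[ℂ] H) :
    (A * B).toLinearMap.range = B.toLinearMap.range.map A.toLinearMap :=
  LinearMap.range_comp _ _

theorem range_mul_le (A B : H →L[ℂ] H) : (A * B).toLinearMap.range ≤ A.toLinearMap.range :=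
  LinearMap.range_comp_le_range _ _

theorem range_le_range_of_mul_eq {A B C : H →L[ℂ] H} (h : A * B = C) :
    C.toLinearMap.range ≤ A.toLinearMap.range :=
  h ▸ range_mul_le A B

/-- If `A`, `B` and `A * B` are partial isometries and left multiplication by `A` does not decrease
the rank of `B`, then the initial projection of `A` fixes the range of `B`. -/
theorem star_mul_self_mul_eq_of_finrank_le [CompleteSpace H] {A B : H →L[ℂ] H}
    [FiniteDimensional ℂ B.toLinearMap.range]
    (hA : A * star A * A = A) (hB : B * star B * B = B)
    (hAB : A * B * star (A * B) * (A * B) = A * B)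
    (hr : Module.finrank ℂ B.toLinearMap.range ≤ Module.finrank ℂ (A * B).toLinearMap.range) :
    star A * A * B = B := by
  set D := B * star (A * B) with hD
  have hDB : D.toLinearMap.range ≤ B.toLinearMap.range := range_mul_le _ _
  have : FiniteDimensional ℂ D.toLinearMap.range := Submodule.finiteDimensional_of_le hDB
  -- As `A * D * (A * B) = A * B`, the rank of `D` is at least that of `A * B`, hence that of `B`.
  have hle : (A * B).toLinearMap.range ≤ D.toLinearMap.range.map A.toLinearMap := by
    rw [← range_mul]
    exact range_le_range_of_mul_eq (B := A * B) (by simpa only [hD, mul_assoc] using hAB)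
  have heq : D.toLinearMap.range = B.toLinearMap.range :=
    Submodule.eq_of_le_of_finrank_le hDB <| hr.trans <|
      (Submodule.finrank_mono hle).trans (Submodule.finrank_map_le _ _)
  ext x
  obtain ⟨y, hy⟩ : B x ∈ D.toLinearMap.range := heq ▸ LinearMap.mem_range_self B.toLinearMap x
  have h : (star A) (A (D y)) = D y :=
    congrArg (fun T : H →L[ℂ] H => T y) (star_mul_self_mul_mul_star_mul hA hB hAB)
  have hy' : D y = B x := hy
  rwa [hy'] at h

theorem finiteDimensional_range_star [CompleteSpace H] {A : H →L[ℂ] H}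
    [FiniteDimensional ℂ A.toLinearMap.range] (hA : A * star A * A = A) :
    FiniteDimensional ℂ (star A).toLinearMap.range ∧
      Module.finrank ℂ (star A).toLinearMap.range ≤ Module.finrank ℂ A.toLinearMap.range := by
  have hle : (star A).toLinearMap.range ≤ A.toLinearMap.range.map (star A).toLinearMap := by
    rw [← range_mul]
    exact range_le_range_of_mul_eq (B := star A) (by simpa [mul_assoc] using congrArg star hA)
  exact ⟨Submodule.finiteDimensional_of_le hle,
    (Submodule.finrank_mono hle).trans (Submodule.finrank_map_le _ _)⟩

theorem finrank_range_star [CompleteSpace H] {A : H →L[ℂ] H}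
    [FiniteDimensional ℂ A.toLinearMap.range] (hA : A * star A * A = A) :
    Module.finrank ℂ (star A).toLinearMap.range = Module.finrank ℂ A.toLinearMap.range := by
  obtain ⟨_, h⟩ := finiteDimensional_range_star hA
  refine le_antisymm h ?_
  have := (finiteDimensional_range_star (A := star A)
    (by simpa [mul_assoc] using congrArg star hA)).2
  rwa [star_star] at this

/-- The range lies in the eigenspace of the compact operator `A * star A` for the eigenvalue 1. -/
theorem finiteDimensional_range_of_isCompactOperator [CompleteSpace H] {A : H →L[ℂ] H}
    (hA : A * star A * A = A) (hc : IsCompactOperator A) :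
    FiniteDimensional ℂ A.toLinearMap.range := by
  have hT : IsCompactOperator (A * star A) := hc.comp_clm (star A)
  have := ContinuousLinearMap.finite_dimensional_eigenspace hT 1 one_ne_zero
  refine Submodule.finiteDimensional_of_le (S₂ := Module.End.eigenspace (A * star A).toLinearMap 1) ?_
  rintro _ ⟨x, rfl⟩
  rw [Module.End.mem_eigenspace_iff, one_smul]
  exact congrArg (fun T : H →L[ℂ] H => T x) hA

end Range

section PartialIsometry

variable {H : Type*} [NormedAddCommGroup H] [InnerProductSpace ℂ H] [CompleteSpace H]

theorem isPartialIsometry_iff_mul_star_mul_self {A : H →L[ℂ] H} :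
    IsPartialIsometry A ↔ A * star A * A = A := by
  refine ⟨fun h => mul_star_mul_self_of_isStarProjection h.1, fun h => ⟨⟨?_, ?_⟩, ⟨?_, ?_⟩⟩⟩
  · rw [IsIdempotentElem, mul_assoc, ← mul_assoc A, h]
  · exact IsSelfAdjoint.star_mul_self A
  · rw [IsIdempotentElem, ← mul_assoc, h]
  · exact IsSelfAdjoint.mul_star_self A

theorem IsPartialIsometry.star {A : H →L[ℂ] H} (h : IsPartialIsometry A) :
    IsPartialIsometry (star A) :=
  ⟨by simpa using h.2, by simpa using h.1⟩

end PartialIsometry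

/-! ### Consequences of irreducibility. -/

section Irreducible

variable {H : Type*} [NormedAddCommGroup H] [InnerProductSpace ℂ H]
  {S : Subsemigroup (H →L[ℂ] H)}

/-- A left ideal of an irreducible semigroup that contains a non-zero operator has ranges spanning
a dense subspace, so that an operator vanishing on these ranges is zero. -/
theorem IsIrreducibleSemigroup.eq_zero_of_mul_eq_zero (hS : IsIrreducibleSemigroup S)
    {J : Set (H →L[ℂ] H)} (hJ : ∀ A ∈ S, ∀ B ∈ J, A * B ≠ 0 → A * B ∈ J)
    {K : H →L[ℂ] H} (hK : K ∈ J) (hK0 : K ≠ 0) {A : H →L[ℂ] H} (hA : ∀ B ∈ J, A * B = 0) :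
    A = 0 := by
  set N : Submodule ℂ H := Submodule.span ℂ {x | ∃ B ∈ J, ∃ y, B y = x} with hN
  have hinv : ∀ T ∈ S, ∀ x ∈ N.topologicalClosure, T x ∈ N.topologicalClosure := by
    intro T hT
    have h1 : ∀ x ∈ N, T x ∈ N := by
      intro x hx
      refine Submodule.span_induction ?_ (by simp) ?_ ?_ hx
      · rintro _ ⟨B, hB, y, rfl⟩
        by_cases h0 : T * B = 0
        · have : T (B y) = 0 := congrArg (fun X : H →L[ℂ] H => X y) h0
          rw [this]; exact N.zero_mem
        · exact Submodule.subset_span ⟨T * B, hJ T hT B hB h0, y, rfl⟩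
      · intro x y _ _ hx hy; rw [map_add]; exact N.add_mem hx hy
      · intro c x _ hx; rw [map_smul]; exact N.smul_mem c hx
    intro x hx
    exact map_mem_closure T.continuous hx h1
  rcases hS _ N.isClosed_topologicalClosure hinv with h | h
  · refine absurd (ContinuousLinearMap.ext fun y => ?_) hK0
    have : K y ∈ N.topologicalClosure :=
      N.le_topologicalClosure (Submodule.subset_span ⟨K, hK, y, rfl⟩)
    simpa [h] using this
  · have hker : N.topologicalClosure ≤ A.toLinearMap.ker := by
      refine N.topologicalClosure_minimal (Submodule.span_le.2 ?_) A.isClosed_ker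
      rintro _ ⟨B, hB, y, rfl⟩
      exact congrArg (fun X : H →L[ℂ] H => X y) (hA B hB)
    ext x
    exact hker (h ▸ Submodule.mem_top)

theorem IsIrreducibleSemigroup.exists_mul_mul_ne_zero (hS : IsIrreducibleSemigroup S)
    {A B : H →L[ℂ] H} (hA0 : A ≠ 0) (hBS : B ∈ S) (hB0 : B ≠ 0) :
    ∃ T ∈ S, A * T * B ≠ 0 := by
  by_contra! h
  -- This closed subspace is invariant because `S` is closed under multiplication, and it contains
  -- the range of `B`.
  let N : Submodule ℂ H := ⨅ T : S, (A * T.1).toLinearMap.ker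
  have hmem : ∀ x, x ∈ N ↔ ∀ T ∈ S, A (T x) = 0 := by intro x; simp [N]
  have hcl : IsClosed (N : Set H) := by
    have : (N : Set H) = ⋂ T : S, ((A * T.1).toLinearMap.ker : Set H) := by simp [N]
    rw [this]
    exact isClosed_iInter fun T => (A * T.1).isClosed_ker
  have hinv : ∀ T ∈ S, ∀ x ∈ N, T x ∈ N := fun T hT x hx =>
    (hmem _).2 fun U hU => (hmem x).1 hx (U * T) (S.mul_mem hU hT)
  rcases hS N hcl hinv with hN | hN
  · refine hB0 (ContinuousLinearMap.ext fun y => ?_)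
    have : B y ∈ N := (hmem _).2 fun T hT => congrArg (fun X : H →L[ℂ] H => X y) (h T hT)
    simpa [hN] using this
  · refine hA0 (hS.eq_zero_of_mul_eq_zero (J := S) (fun _ h1 _ h2 _ => S.mul_mem h1 h2) hBS hB0
      fun T hT => ContinuousLinearMap.ext fun x => ?_)
    exact (hmem x).1 (hN ▸ Submodule.mem_top) T hT

end Irreducible

/-! ### Non-zero members of minimal rank. -/

section MinimalRank

variable {H : Type*} [NormedAddCommGroup H] [InnerProductSpace ℂ H]
  {S : Subsemigroup (H →L[ℂ] H)} {A B : H →L[ℂ] H}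

/-- `A` has the least rank among the non-zero members of `S`, and this rank is finite. -/
structure IsMinimalRank (S : Subsemigroup (H →L[ℂ] H)) (A : H →L[ℂ] H) : Prop where
  mem : A ∈ S
  ne_zero : A ≠ 0
  finiteDimensional : FiniteDimensional ℂ A.toLinearMap.range
  finrank_le : ∀ B ∈ S, B ≠ 0 → FiniteDimensional ℂ B.toLinearMap.range →
    Module.finrank ℂ A.toLinearMap.range ≤ Module.finrank ℂ B.toLinearMap.range

theorem exists_isMinimalRank (h : ∃ A ∈ S, A ≠ 0 ∧ FiniteDimensional ℂ A.toLinearMap.range) :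
    ∃ A, IsMinimalRank S A := by
  obtain ⟨A, ⟨hA, hA0, hAf⟩, hmin⟩ := exists_minimalFor_of_wellFoundedLT
    (fun A : H →L[ℂ] H => A ∈ S ∧ A ≠ 0 ∧ FiniteDimensional ℂ A.toLinearMap.range)
    (fun A => Module.finrank ℂ A.toLinearMap.range) h
  exact ⟨A, hA, hA0, hAf, fun B hB hB0 hBf =>
    (le_total _ _).elim id fun hle => hmin ⟨hB, hB0, hBf⟩ hle⟩

theorem IsMinimalRank.finrank_eq (hA : IsMinimalRank S A) (hB : IsMinimalRank S B) :
    Module.finrank ℂ A.toLinearMap.range = Module.finrank ℂ B.toLinearMap.range :=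
  le_antisymm (hA.finrank_le B hB.mem hB.ne_zero hB.finiteDimensional)
    (hB.finrank_le A hA.mem hA.ne_zero hA.finiteDimensional)

theorem IsMinimalRank.mul_left (hB : IsMinimalRank S B) (hA : A ∈ S) (h0 : A * B ≠ 0) :
    IsMinimalRank S (A * B) := by
  have := hB.finiteDimensional
  refine ⟨S.mul_mem hA hB.mem, h0, ?_, fun C hC hC0 hCf => ?_⟩
  · rw [range_mul]; infer_instance
  · rw [range_mul]
    exact (Submodule.finrank_map_le _ _).trans (hB.finrank_le C hC hC0 hCf)

theorem IsMinimalRank.mul_right (hA : IsMinimalRank S A) (hB : B ∈ S) (h0 : A * B ≠ 0) :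
    IsMinimalRank S (A * B) := by
  have := hA.finiteDimensional
  exact ⟨S.mul_mem hA.mem hB, h0, Submodule.finiteDimensional_of_le (range_mul_le A B),
    fun C hC hC0 hCf =>
      (Submodule.finrank_mono (range_mul_le A B)).trans (hA.finrank_le C hC hC0 hCf)⟩

variable [CompleteSpace H]

theorem IsMinimalRank.star_mul_self_mul (hpi : ∀ A ∈ S, IsPartialIsometry A)
    (hB : IsMinimalRank S B) (hA : A ∈ S) (h0 : A * B ≠ 0) : star A * A * B = B := by
  have := hB.finiteDimensional
  have h := fun X hX => isPartialIsometry_iff_mul_star_mul_self.1 (hpi X hX)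
  exact star_mul_self_mul_eq_of_finrank_le (h A hA) (h B hB.mem) (h _ (S.mul_mem hA hB.mem))
    (hB.finrank_eq (hB.mul_left hA h0)).le

/-- The rank argument is run on adjoints directly, since `star A` and `star B` need not lie in `S`;
adjoints preserve the ranks involved. -/
theorem IsMinimalRank.mul_mul_star_self (hpi : ∀ A ∈ S, IsPartialIsometry A)
    (hA : IsMinimalRank S A) (hB : B ∈ S) (h0 : A * B ≠ 0) : A * (B * star B) = A := by
  have := hA.finiteDimensional
  have h := fun X hX => isPartialIsometry_iff_mul_star_mul_self.1 (hpi X hX)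
  have hs := fun X hX => isPartialIsometry_iff_mul_star_mul_self.1 (hpi X hX).star
  have hAB := hA.mul_right hB h0
  have := hAB.finiteDimensional
  have := (finiteDimensional_range_star (h A hA.mem)).1
  have key := star_mul_self_mul_eq_of_finrank_le (hs B hB) (hs A hA.mem)
    (by rw [← star_mul]; exact hs _ hAB.mem)
    (by rw [← star_mul, finrank_range_star (h _ hAB.mem), finrank_range_star (h _ hA.mem),
      hA.finrank_eq hAB])
  simpa [mul_assoc] using congrArg star key

/-- `star A * A` fixes the range of `B`, which gives one inclusion; the dimensions agree by
minimality. -/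
theorem IsMinimalRank.range_eq_range_star (hpi : ∀ A ∈ S, IsPartialIsometry A)
    (hA : IsMinimalRank S A) (hB : IsMinimalRank S B) (h0 : A * B ≠ 0) :
    B.toLinearMap.range = (star A).toLinearMap.range := by
  have hA' := isPartialIsometry_iff_mul_star_mul_self.1 (hpi A hA.mem)
  have := hA.finiteDimensional
  have := (finiteDimensional_range_star hA').1
  refine Submodule.eq_of_le_of_finrank_eq
    (range_le_range_of_mul_eq (B := A * B) ?_) ?_
  · rw [← mul_assoc, hB.star_mul_self_mul hpi hA.mem h0]
  · rw [finrank_range_star hA', hA.finrank_eq hB]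

theorem IsMinimalRank.exists_range_star_eq (hpi : ∀ A ∈ S, IsPartialIsometry A)
    (hS : IsIrreducibleSemigroup S) (hB : IsMinimalRank S B) :
    ∃ A, IsMinimalRank S A ∧ (star A).toLinearMap.range = B.toLinearMap.range := by
  -- With `B * T * B` non-zero, `B * T` has minimal rank and its initial space is the range of `B`.
  obtain ⟨T, hT, h0⟩ := hS.exists_mul_mul_ne_zero hB.ne_zero hB.mem hB.ne_zero
  have hA := hB.mul_right hT (left_ne_zero_of_mul h0)
  exact ⟨_, hA, (hA.range_eq_range_star hpi hB h0).symm⟩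

theorem IsMinimalRank.exists_range_eq_star (hpi : ∀ A ∈ S, IsPartialIsometry A)
    (hS : IsIrreducibleSemigroup S) (hA : IsMinimalRank S A) :
    ∃ B, IsMinimalRank S B ∧ B.toLinearMap.range = (star A).toLinearMap.range := by
  obtain ⟨T, hT, h0⟩ := hS.exists_mul_mul_ne_zero hA.ne_zero hA.mem hA.ne_zero
  rw [mul_assoc] at h0
  have hB := hA.mul_left hT (right_ne_zero_of_mul h0)
  exact ⟨_, hB, hA.range_eq_range_star hpi hB h0⟩

end MinimalRank

/-! ### Operators respecting a family of blocks. -/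

section BlockPartialIsometry

variable {H : Type*} [NormedAddCommGroup H] [InnerProductSpace ℂ H] [CompleteSpace H]
  {F : Set (Submodule ℂ H)} {A B : H →L[ℂ] H}

/-- On each member of the family `F`, the operator `A` is either zero or an isometry into some
member of `F`. -/
def IsBlockPartialIsometry (F : Set (Submodule ℂ H)) (A : H →L[ℂ] H) : Prop :=
  ∀ M ∈ F, (∀ x ∈ M, A x = 0) ∨
    ((∃ N ∈ F, ∀ x ∈ M, A x ∈ N) ∧ ∀ x ∈ M, (star A) (A x) = x)

theorem IsBlockPartialIsometry.mul (hA : IsBlockPartialIsometry F A)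
    (hB : IsBlockPartialIsometry F B) : IsBlockPartialIsometry F (A * B) := by
  intro M hM
  rcases hB M hM with h | ⟨⟨N, hN, hMN⟩, hB'⟩
  · exact Or.inl fun x hx => by simp [h x hx]
  rcases hA N hN with h | ⟨⟨L, hL, hNL⟩, hA'⟩
  · exact Or.inl fun x hx => h _ (hMN x hx)
  · refine Or.inr ⟨⟨L, hL, fun x hx => hNL _ (hMN x hx)⟩, fun x hx => ?_⟩
    rw [star_mul]
    change (star B) ((star A) (A (B x))) = x
    rw [hA' _ (hMN x hx), hB' x hx]

theorem IsBlockPartialIsometry.mul_star_mul_self_apply (hA : IsBlockPartialIsometry F A)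
    {M : Submodule ℂ H} (hM : M ∈ F) {x : H} (hx : x ∈ M) : (A * star A * A) x = A x := by
  change A ((star A) (A x)) = A x
  rcases hA M hM with h | ⟨_, h⟩
  · simp [h x hx]
  · rw [h x hx]

variable {S : Subsemigroup (H →L[ℂ] H)}

theorem isBlockPartialIsometry_of_mem (hpi : ∀ A ∈ S, IsPartialIsometry A) (hA : A ∈ S) :
    IsBlockPartialIsometry {M | ∃ B, IsMinimalRank S B ∧ B.toLinearMap.range = M} A := by
  rintro _ ⟨B, hB, rfl⟩
  by_cases h0 : A * B = 0
  · left
    rintro _ ⟨y, rfl⟩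
    exact congrArg (fun X : H →L[ℂ] H => X y) h0
  · refine Or.inr ⟨⟨_, ⟨A * B, hB.mul_left hA h0, rfl⟩, ?_⟩, ?_⟩
    · rintro _ ⟨y, rfl⟩
      exact ⟨y, rfl⟩
    · rintro _ ⟨y, rfl⟩
      exact congrArg (fun X : H →L[ℂ] H => X y) (hB.star_mul_self_mul hpi hA h0)

/-- Writing a block as the range of `star C` turns the action of `star A` on it into `star (C * A)`,
where `C * A` is zero or again of minimal rank. -/
theorem isBlockPartialIsometry_star_of_mem (hpi : ∀ A ∈ S, IsPartialIsometry A)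
    (hS : IsIrreducibleSemigroup S) (hA : A ∈ S) :
    IsBlockPartialIsometry {M | ∃ B, IsMinimalRank S B ∧ B.toLinearMap.range = M} (star A) := by
  rintro _ ⟨B, hB, rfl⟩
  obtain ⟨C, hC, hCB⟩ := hB.exists_range_star_eq hpi hS
  rw [← hCB]
  by_cases h0 : C * A = 0
  · left
    rintro _ ⟨y, rfl⟩
    have h1 : star A * star C = 0 := by rw [← star_mul, h0, star_zero]
    exact congrArg (fun X : H →L[ℂ] H => X y) h1
  · obtain ⟨D, hD, hDr⟩ := (hC.mul_right hA h0).exists_range_eq_star hpi hS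
    refine Or.inr ⟨⟨_, ⟨D, hD, rfl⟩, ?_⟩, ?_⟩
    · rintro _ ⟨y, rfl⟩
      rw [hDr, star_mul]
      exact ⟨y, rfl⟩
    · rintro _ ⟨y, rfl⟩
      have h1 : A * star A * star C = star C := by
        simpa [mul_assoc] using congrArg star (hC.mul_mul_star_self hpi hA h0)
      rw [star_star]
      exact congrArg (fun X : H →L[ℂ] H => X y) h1

end BlockPartialIsometry

theorem corollary3p14 {H : Type*} [NormedAddCommGroup H] [InnerProductSpace ℂ H]
    [CompleteSpace H] [TopologicalSpace.SeparableSpace H]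
    (S : Subsemigroup (H →L[ℂ] H))
    (hpi : ∀ A ∈ S, IsPartialIsometry A)
    (hirr : IsIrreducibleSemigroup S)
    (hcpt : ∃ K ∈ S, K ≠ 0 ∧ IsCompactOperator K) :
    ∀ A ∈ selfAdjointSemigroupGenerated S, IsPartialIsometry A := by
  obtain ⟨K, hK, hK0, hKc⟩ := hcpt
  obtain ⟨E, hE⟩ := exists_isMinimalRank ⟨K, hK, hK0, finiteDimensional_range_of_isCompactOperator
    (isPartialIsometry_iff_mul_star_mul_self.1 (hpi K hK)) hKc⟩
  intro A hA
  have hblock : IsBlockPartialIsometry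
      {M | ∃ B, IsMinimalRank S B ∧ B.toLinearMap.range = M} A := by
    refine Subsemigroup.closure_induction (fun X hX => ?_) (fun _ _ _ _ => .mul) hA
    rcases hX with hX | hX
    · exact isBlockPartialIsometry_of_mem hpi hX
    · simpa using isBlockPartialIsometry_star_of_mem hpi hirr (Set.mem_star.1 hX)
  rw [isPartialIsometry_iff_mul_star_mul_self, ← sub_eq_zero]
  refine hirr.eq_zero_of_mul_eq_zero (J := {B | IsMinimalRank S B})
    (fun T hT B hB h0 => IsMinimalRank.mul_left hB hT h0) hE hE.ne_zero fun B hB => ?_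
  ext y
  exact sub_eq_zero.2 (hblock.mul_star_mul_self_apply ⟨B, hB, rfl⟩ ⟨y, rfl⟩)
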